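/- A \emph{compact linear order} is a linearly ordered set that is compact in its order topology. For a cardinal $\kappa$, a base $\mathcal B$ of a topological space is called \emph{$\kappa^{\mathrm{op}}$-like} if no element of $\mathcal B$ is included in $\kappa$-many elements of $\mathcal B$. The \emph{Noetherian type} of a space is the least infinite cardinal $\kappa$ such that the space has a $\kappa^{\mathrm{op}}$-like base. \textbf{Theorem.} Let $X=\prod_{i\in I}X_i$, with the product topology, where $I$ is a countable (possibly finite) set and each $X_i$ is a compact linear order. The following are equivalent. \begin{enumerate} \item $X$ is metrizable. \item $X$ has an $\omega^{\mathrm{op}}$-like base. \item $X$ has an $\omega_1^{\mathrm{op}}$-like base. \item $X$ is separable and has an $\omega_1^{\mathrm{op}}$-like base. \end{enumerate} In particular, no compact linear order has Noetherian type $\omega_1$. -/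

import Mathlib

open scoped Cardinal

universe u

/-- A poset `P` is `κ^op`-like if no element of `P` is below (`≤`) `κ`-many elements of `P`. -/
def IsOpLike (κ : Cardinal.{u}) (P : Type u) [PartialOrder P] : Prop :=
  ∀ a : P, ¬ κ ≤ #{b : P // a ≤ b}

/-- The space `X` has a `κ^op`-like base: a base `B` of its topology which, ordered by inclusion
(the order that the subtype `↥B` inherits from `Set X`), is a `κ^op`-like poset. -/
def HasOpLikeBase (κ : Cardinal.{u}) (X : Type u) [TopologicalSpace X] : Prop :=
  ∃ B : Set (Set X), TopologicalSpace.IsTopologicalBasis B ∧ IsOpLike κ B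

/-- The Noetherian type of a space `X`: the least infinite cardinal `κ` such that `X` has a
`κ^op`-like base. -/
noncomputable def noetherianType (X : Type u) [TopologicalSpace X] : Cardinal.{u} :=
  sInf {κ : Cardinal.{u} | ℵ₀ ≤ κ ∧ HasOpLikeBase κ X}

/-- The infimum defining the Noetherian type is over a nonempty set, hence it is attained. -/
theorem noetherianType_spec (X : Type u) [TopologicalSpace X] :
    ℵ₀ ≤ noetherianType X ∧ HasOpLikeBase (noetherianType X) X := by
  refine csInf_mem (s := {κ : Cardinal.{u} | ℵ₀ ≤ κ ∧ HasOpLikeBase κ X})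
    ⟨max ℵ₀ (Order.succ #(Set X)), le_max_left _ _, {U | IsOpen U},
      TopologicalSpace.isTopologicalBasis_opens, fun a h => ?_⟩
  have h1 : #{b : {U : Set X | IsOpen U} // a ≤ b} ≤ #(Set X) :=
    (Cardinal.mk_subtype_le _).trans (Cardinal.mk_set_le _)
  exact absurd ((le_max_right _ _).trans (h.trans h1)) (Order.lt_succ _).not_ge

open Set Filter Topology TopologicalSpace

theorem accPt_of_mem_closure_of_notMem {Y : Type*} [TopologicalSpace Y] {A : Set Y} {p : Y} (h : p ∈ closure A) (hp : p ∉ A) :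
    AccPt p (𝓟 A) := by
  rw [accPt_iff_nhds]
  intro W hW
  obtain ⟨z, hz, hzA⟩ := mem_closure_iff_nhds.1 h W hW
  exact ⟨z, ⟨hz, hzA⟩, fun e => hp (e ▸ hzA)⟩

theorem Set.Infinite.exists_lt_lt {Y : Type*} [LinearOrder Y] {S : Set Y} (hS : S.Infinite) :
    ∃ a ∈ S, ∃ b ∈ S, ∃ c ∈ S, a < b ∧ b < c := by
  obtain ⟨t, htS, ht⟩ := hS.exists_subset_card_eq 3
  have hm (i : Fin 3) : t.orderEmbOfFin ht i ∈ S := htS (t.orderEmbOfFin_mem ht i)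
  exact ⟨_, hm 0, _, hm 1, _, hm 2, (t.orderEmbOfFin ht).strictMono (by decide),
    (t.orderEmbOfFin ht).strictMono (by decide)⟩

section LinearOrder

variable {Y : Type*} [LinearOrder Y] [TopologicalSpace Y]

/-- The nonempty open sets that are singletons or open intervals with endpoints in `A`. -/
def traceOpens (A : Set Y) : Set (Set Y) :=
  {V | V.Nonempty ∧ IsOpen V ∧ ((∃ a ∈ A, V = {a}) ∨ ∃ a ∈ A, ∃ b ∈ A, V = Ioo a b)}

/-- Every neighbourhood of `x` includes one of the open sets in `traceOpens A`. -/
def Captured (A : Set Y) (x : Y) : Prop :=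
  ∀ W ∈ 𝓝 x, ∃ V ∈ traceOpens A, V ⊆ W

theorem traceOpens_mono {A A' : Set Y} (h : A ⊆ A') : traceOpens A ⊆ traceOpens A' := by
  rintro V ⟨h1, h2, ⟨a, ha, rfl⟩ | ⟨a, ha, b, hb, rfl⟩⟩
  · exact ⟨h1, h2, Or.inl ⟨a, h ha, rfl⟩⟩
  · exact ⟨h1, h2, Or.inr ⟨a, h ha, b, h hb, rfl⟩⟩

theorem traceOpens_countable {A : Set Y} (hA : A.Countable) : (traceOpens A).Countable := by
  refine ((hA.image fun a => ({a} : Set Y)).union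
    ((hA.prod hA).image fun q => Ioo q.1 q.2)).mono ?_
  rintro V ⟨-, -, ⟨a, ha, rfl⟩ | ⟨a, ha, b, hb, rfl⟩⟩
  · exact Or.inl ⟨a, ha, rfl⟩
  · exact Or.inr ⟨(a, b), ⟨ha, hb⟩, rfl⟩

variable [OrderTopology Y]

theorem exists_mem_nhds_Icc_subset {x : Y} {W : Set Y} (hW : W ∈ 𝓝 x) :
    ∃ S ∈ 𝓝 x, ∀ a ∈ S, ∀ b ∈ S, Icc a b ⊆ W := by
  have h : Tendsto (fun q : Y × Y => Icc q.1 q.2) (𝓝 x ×ˢ 𝓝 x) (𝓝 x).smallSets :=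
    tendsto_fst.Icc tendsto_snd
  obtain ⟨S, hS, h'⟩ := mem_prod_same_iff.1 (tendsto_smallSets_iff.1 h W hW)
  exact ⟨S, hS, fun a ha b hb => h' (mk_mem_prod ha hb)⟩

theorem AccPt.captured {A : Set Y} {x : Y} (hx : AccPt x (𝓟 A)) : Captured A x := by
  intro W hW
  obtain ⟨S, hS, hSW⟩ := exists_mem_nhds_Icc_subset hW
  have hinf : (S ∩ A).Infinite := by
    intro hfin
    obtain ⟨y, ⟨⟨hyS, hyF⟩, hyA⟩, hne⟩ := accPt_iff_nhds.1 hx (S ∩ ((S ∩ A) \ {x})ᶜ)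
      (inter_mem hS ((hfin.subset sdiff_subset).isClosed.isOpen_compl.mem_nhds (by simp)))
    exact hyF ⟨⟨hyS, hyA⟩, hne⟩
  obtain ⟨a, ha, b, hb, c, hc, hab, hbc⟩ := hinf.exists_lt_lt
  exact ⟨Ioo a c, ⟨⟨b, hab, hbc⟩, isOpen_Ioo, Or.inr ⟨a, ha.2, c, hc.2, rfl⟩⟩,
    Ioo_subset_Icc_self.trans (hSW a ha.1 c hc.1)⟩

theorem Dense.captured {A : Set Y} (hA : Dense A) (x : Y) : Captured A x := by
  by_cases hx : AccPt x (𝓟 A)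
  · exact hx.captured
  rw [accPt_iff_nhds] at hx
  push Not at hx
  obtain ⟨W, hW, hWA⟩ := hx
  obtain ⟨O, hOW, hO, hxO⟩ := mem_nhds_iff.1 hW
  have hOx : O = {x} := by
    refine Subset.antisymm (fun y hy => ?_) (singleton_subset_iff.2 hxO)
    by_contra hyx
    obtain ⟨z, hz, hzA⟩ := hA.inter_open_nonempty (O \ {x}) (hO.sdiff isClosed_singleton) ⟨y, hy, hyx⟩
    exact hz.2 (hWA z ⟨hOW hz.1, hzA⟩)
  subst hOx
  obtain ⟨z, hz, hzA⟩ := hA.inter_open_nonempty {x} hO ⟨x, rfl⟩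
  obtain rfl : z = x := hz
  exact fun W hW => ⟨{z}, ⟨⟨z, rfl⟩, hO, Or.inl ⟨z, hzA, rfl⟩⟩,
    singleton_subset_iff.2 (mem_of_mem_nhds hW)⟩

variable [CompactSpace Y]

theorem CompactSpace.exists_isLUB {S : Set Y} (hS : S.Nonempty) : ∃ s, IsLUB S s := by
  obtain ⟨s, hs, hsm⟩ := isClosed_closure.isCompact.exists_isGreatest hS.closure
  exact ⟨s, fun y hy => hsm (subset_closure hy),
    fun b hb => closure_minimal (fun y hy => hb hy) isClosed_Iic hs⟩

theorem CompactSpace.exists_isGLB {S : Set Y} (hS : S.Nonempty) : ∃ s, IsGLB S s := by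
  obtain ⟨s, hs, hsm⟩ := isClosed_closure.isCompact.exists_isLeast hS.closure
  exact ⟨s, fun y hy => hsm (subset_closure hy),
    fun b hb => closure_minimal (fun y hy => hb hy) isClosed_Ici hs⟩

/-- A set containing the extreme points and a point of every nonempty interval between its points. -/
structure BetweenClosed (A : Set Y) : Prop where
  bot_mem : ∀ x, IsBot x → x ∈ A
  top_mem : ∀ x, IsTop x → x ∈ A
  between : ∀ a ∈ A, ∀ b ∈ A, (Ioo a b).Nonempty → (Ioo a b ∩ A).Nonempty

theorem BetweenClosed.exists_accPt {A : Set Y} (hA : BetweenClosed A) {x : Y}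
    (hx : x ∉ closure A) :
    ∃ p, p ∉ A ∧ AccPt p (𝓟 A) ∧
      (IsLUB {a ∈ A | a ≤ x} p ∧ {a ∈ A | a ≤ x}.Nonempty ∨
        IsGLB {a ∈ A | x ≤ a} p ∧ {a ∈ A | x ≤ a}.Nonempty) := by
  have hne1 : {a ∈ A | a ≤ x}.Nonempty := by
    obtain ⟨s, -, hs⟩ := isCompact_univ.exists_isLeast (α := Y) ⟨x, trivial⟩
    exact ⟨s, hA.bot_mem s fun y => hs trivial, hs trivial⟩
  have hne2 : {a ∈ A | x ≤ a}.Nonempty := by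
    obtain ⟨s, -, hs⟩ := isCompact_univ.exists_isGreatest (α := Y) ⟨x, trivial⟩
    exact ⟨s, hA.top_mem s fun y => hs trivial, hs trivial⟩
  obtain ⟨p, hp⟩ := CompactSpace.exists_isLUB hne1
  obtain ⟨q, hq⟩ := CompactSpace.exists_isGLB hne2
  have hpc : p ∈ closure A := closure_mono (fun a ha => ha.1) (hp.mem_closure hne1)
  have hqc : q ∈ closure A := closure_mono (fun a ha => ha.1) (hq.mem_closure hne2)
  by_cases hpA : p ∈ A
  · by_cases hqA : q ∈ A
    · have hpx : p < x := lt_of_le_of_ne (hp.2 fun a ha => ha.2) fun e => hx (e ▸ hpc)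
      have hxq : x < q := lt_of_le_of_ne (hq.2 fun a ha => ha.2) fun e => hx (e ▸ hqc)
      obtain ⟨z, ⟨hpz, hzq⟩, hzA⟩ := hA.between p hpA q hqA ⟨x, hpx, hxq⟩
      rcases le_total z x with h | h
      · exact absurd (hp.1 ⟨hzA, h⟩) hpz.not_ge
      · exact absurd (hq.1 ⟨hzA, h⟩) hzq.not_ge
    · exact ⟨q, hqA, accPt_of_mem_closure_of_notMem hqc hqA, Or.inr ⟨hq, hne2⟩⟩
  · exact ⟨p, hpA, accPt_of_mem_closure_of_notMem hpc hpA, Or.inl ⟨hp, hne1⟩⟩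

theorem BetweenClosed.exists_captured [Nonempty Y] {A : Set Y} (hA : BetweenClosed A) :
    ∃ x, Captured A x := by
  by_cases h : Dense A
  · exact ⟨Classical.arbitrary Y, h.captured _⟩
  · simp only [Dense, not_forall] at h
    obtain ⟨x, hx⟩ := h
    obtain ⟨p, -, hp, -⟩ := hA.exists_accPt hx
    exact ⟨p, hp.captured⟩


theorem exists_isLUB_notMem {A O : Set Y} {x p : Y} (hpA : p ∉ A)
    (hp : IsLUB {a ∈ A | a ≤ x} p) (hpc : p ∈ closure {a ∈ A | a ≤ x}) (hO : O ∈ 𝓝 p)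
    (hxO : x ∉ O) : ∃ a ∈ A, a ∈ O ∧ ∃ s ∉ A, IsLUB {y | a ≤ y ∧ Icc a y ⊆ O} s := by
  obtain ⟨S, hS, hSO⟩ := exists_mem_nhds_Icc_subset hO
  obtain ⟨a, haS, ha⟩ := mem_closure_iff_nhds.1 hpc S hS
  have hap : Icc a p ⊆ O := hSO a haS p (mem_of_mem_nhds hS)
  obtain ⟨s, hs⟩ := CompactSpace.exists_isLUB (S := {y | a ≤ y ∧ Icc a y ⊆ O}) ⟨p, hp.1 ha, hap⟩
  refine ⟨a, ha.1, hap ⟨le_rfl, hp.1 ha⟩, s, fun hsA => ?_, hs⟩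
  have hsx : s ≤ x := hs.2 fun y hy => not_lt.1 fun hxy => hxO (hy.2 ⟨ha.2, hxy.le⟩)
  exact hpA (le_antisymm (hs.1 ⟨hp.1 ha, hap⟩) (hp.1 ⟨hsA, hsx⟩) ▸ hsA)

theorem exists_isGLB_notMem {A O : Set Y} {x p : Y} (hpA : p ∉ A)
    (hp : IsGLB {a ∈ A | x ≤ a} p) (hpc : p ∈ closure {a ∈ A | x ≤ a}) (hO : O ∈ 𝓝 p)
    (hxO : x ∉ O) : ∃ a ∈ A, a ∈ O ∧ ∃ s ∉ A, IsGLB {y | y ≤ a ∧ Icc y a ⊆ O} s := by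
  obtain ⟨S, hS, hSO⟩ := exists_mem_nhds_Icc_subset hO
  obtain ⟨a, haS, ha⟩ := mem_closure_iff_nhds.1 hpc S hS
  have hap : Icc p a ⊆ O := hSO p (mem_of_mem_nhds hS) a haS
  obtain ⟨s, hs⟩ := CompactSpace.exists_isGLB (S := {y | y ≤ a ∧ Icc y a ⊆ O}) ⟨p, hp.1 ha, hap⟩
  refine ⟨a, ha.1, hap ⟨hp.1 ha, le_rfl⟩, s, fun hsA => ?_, hs⟩
  have hsx : x ≤ s := hs.2 fun y hy => not_lt.1 fun hxy => hxO (hy.2 ⟨hxy.le, ha.2⟩)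
  exact hpA (le_antisymm (hp.1 ⟨hsA, hsx⟩) (hs.1 ⟨hp.1 ha, hap⟩) ▸ hsA)

/-- The ends of the maximal intervals of `O` reaching up or down from `a`. -/
def intervalEnds (O : Set Y) (a : Y) : Set Y :=
  {s | IsLUB {y | a ≤ y ∧ Icc a y ⊆ O} s ∨ IsGLB {y | y ≤ a ∧ Icc y a ⊆ O} s}

theorem BetweenClosed.dense {A : Set Y} (hA : BetweenClosed A)
    (h : ∀ p, Captured A p → ∀ W ∈ 𝓝 p, ∃ O ∈ 𝓝 p, O ⊆ W ∧ ∀ a ∈ A, a ∈ O → intervalEnds O a ⊆ A) :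
    Dense A := by
  intro x
  by_contra hx
  obtain ⟨p, hpA, hacc, hp⟩ := hA.exists_accPt hx
  have hpx : p ≠ x := fun e => hx (e ▸ mem_closure_iff_clusterPt.2 hacc.clusterPt)
  obtain ⟨O, hO, hOx, hends⟩ := h p hacc.captured _ (isOpen_compl_singleton.mem_nhds hpx)
  have hxO : x ∉ O := fun hxO => hOx hxO rfl
  rcases hp with ⟨hp, hne⟩ | ⟨hp, hne⟩
  · obtain ⟨a, haA, haO, s, hsA, hs⟩ :=
      exists_isLUB_notMem hpA hp (hp.mem_closure hne) hO hxO
    exact hsA (hends a haA haO (Or.inl hs))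
  · obtain ⟨a, haA, haO, s, hsA, hs⟩ :=
      exists_isGLB_notMem hpA hp (hp.mem_closure hne) hO hxO
    exact hsA (hends a haA haO (Or.inr hs))

end LinearOrder

section Pi

variable {ι : Type*} {X : ι → Type*} [∀ i, LinearOrder (X i)] [∀ i, TopologicalSpace (X i)]

theorem intervalEnds_countable {Y : Type*} [LinearOrder Y] (O : Set Y) (a : Y) :
    (intervalEnds O a).Countable :=
  .union (Set.Subsingleton.countable fun _ h _ h' => IsLUB.unique h h')
    (Set.Subsingleton.countable fun _ h _ h' => IsGLB.unique h h')

/-- The open cylinders over the members of `traceOpens` in the coordinate spaces. -/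
def traceCylinders (A : Set (Σ i, X i)) : Set (Set (∀ i, X i)) :=
  ⋃ i, (fun V => Function.eval i ⁻¹' V) '' traceOpens (Sigma.mk i ⁻¹' A)

/-- The sets including a nonempty box that is a finite intersection of `traceCylinders A`. -/
def boxSupersets (A : Set (Σ i, X i)) : Set (Set (∀ i, X i)) :=
  {U | ∃ C : Set (Set (∀ i, X i)), C.Finite ∧ C ⊆ traceCylinders A ∧
    (⋂₀ C).Nonempty ∧ ⋂₀ C ⊆ U}

theorem traceCylinders_mono {A A' : Set (Σ i, X i)} (h : A ⊆ A') :
    traceCylinders A ⊆ traceCylinders A' :=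
  iUnion_mono fun _ => image_mono (traceOpens_mono (preimage_mono h))

theorem traceCylinders_countable [Countable ι] {A : Set (Σ i, X i)} (hA : A.Countable) :
    (traceCylinders A).Countable :=
  countable_iUnion fun _ =>
    (traceOpens_countable (hA.preimage sigma_mk_injective)).image _

theorem traceCylinders_iUnion {A : ℕ → Set (Σ i, X i)} (hA : Monotone A) :
    traceCylinders (⋃ n, A n) ⊆ ⋃ n, traceCylinders (A n) := by
  intro W hW
  obtain ⟨i, V, ⟨hne, ho, hV⟩, rfl⟩ := mem_iUnion.1 hW
  simp only [preimage_iUnion, mem_iUnion] at hV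
  rcases hV with ⟨a, ⟨n, ha⟩, rfl⟩ | ⟨a, ⟨n, ha⟩, b, ⟨m, hb⟩, rfl⟩
  · exact mem_iUnion.2 ⟨n, mem_iUnion.2 ⟨i, _, ⟨hne, ho, Or.inl ⟨a, ha, rfl⟩⟩, rfl⟩⟩
  · exact mem_iUnion.2 ⟨max n m, mem_iUnion.2 ⟨i, _, ⟨hne, ho, Or.inr
      ⟨a, hA (le_max_left _ _) ha, b, hA (le_max_right _ _) hb, rfl⟩⟩, rfl⟩⟩

theorem boxSupersets_iUnion {A : ℕ → Set (Σ i, X i)} (hA : Monotone A) :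
    boxSupersets (⋃ n, A n) ⊆ ⋃ n, boxSupersets (A n) := by
  rintro U ⟨C, hC, hCA, hne, hCU⟩
  obtain ⟨n, hn⟩ := (directed_of_isDirected_le (f := fun n => traceCylinders (A n))
    (r := (· ⊆ ·)) fun _ _ h => traceCylinders_mono (hA h)).exists_mem_subset_of_finset_subset_biUnion
    (s := hC.toFinset) (by simpa using hCA.trans (traceCylinders_iUnion hA))
  rw [hC.coe_toFinset] at hn
  exact mem_iUnion.2 ⟨n, C, hC, hn, hne, hCU⟩

theorem inter_boxSupersets_countable [Countable ι] {B : Set (Set (∀ i, X i))}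
    (hB : ∀ W : Set (∀ i, X i), IsOpen W → W.Nonempty → {U ∈ B | W ⊆ U}.Countable)
    {A : Set (Σ i, X i)} (hA : A.Countable) : (B ∩ boxSupersets A).Countable := by
  have hC := countable_ofPred_finite_subset (traceCylinders_countable hA)
  refine ((hC.mono (sep_subset _ fun C => (⋂₀ C).Nonempty)).biUnion
    (t := fun C _ => {U ∈ B | ⋂₀ C ⊆ U}) fun C hC => hB _ ?_ hC.2).mono ?_
  · refine hC.1.1.isOpen_sInter fun W hW => ?_
    obtain ⟨i, V, hV, rfl⟩ := mem_iUnion.1 (hC.1.2 hW)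
    exact hV.2.1.preimage (continuous_apply i)
  · rintro U ⟨hU, C, hC, hCA, hne, hCU⟩
    exact mem_biUnion (x := C) ⟨⟨hC, hCA⟩, hne⟩ ⟨hU, hCU⟩

theorem mem_boxSupersets {A : Set (Σ i, X i)} {p : ∀ i, X i}
    (hp : ∀ i, Captured (Sigma.mk i ⁻¹' A) (p i)) {U : Set (∀ i, X i)} (hU : U ∈ 𝓝 p) :
    U ∈ boxSupersets A := by
  classical
  obtain ⟨O, hOU, hO, hpO⟩ := mem_nhds_iff.1 hU
  obtain ⟨J, u, hu, huO⟩ := isOpen_pi_iff.1 hO p hpO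
  have hV (i : ι) : ∃ V ∈ traceOpens (Sigma.mk i ⁻¹' A), i ∈ J → V ⊆ u i := by
    by_cases hi : i ∈ J
    · obtain ⟨V, hV, hVu⟩ := hp i (u i) ((hu i hi).1.mem_nhds (hu i hi).2)
      exact ⟨V, hV, fun _ => hVu⟩
    · obtain ⟨V, hV, -⟩ := hp i univ univ_mem
      exact ⟨V, hV, fun h => absurd h hi⟩
  choose V hV hVu using hV
  choose x hx using fun i => (hV i).1
  refine ⟨(fun i => Function.eval i ⁻¹' V i) '' J, J.finite_toSet.image _, ?_,
    ⟨x, ?_⟩, fun y hy => hOU (huO fun i hi => hVu i hi (hy _ ⟨i, hi, rfl⟩))⟩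
  · rintro _ ⟨i, -, rfl⟩
    exact mem_iUnion.2 ⟨i, _, hV i, rfl⟩
  · rintro _ ⟨i, -, rfl⟩
    exact hx i

/-- One step of closing off `A` under extreme points, points of intervals, and interval ends. -/
def closureStep (B : Set (Set (∀ i, X i))) (A : Set (Σ i, X i)) : Set (Σ i, X i) :=
  A ∪ ⋃ i, Sigma.mk i '' ({x | IsBot x} ∪ {x | IsTop x} ∪
    (⋃ a ∈ Sigma.mk i ⁻¹' A, ⋃ b ∈ Sigma.mk i ⁻¹' A,
      {z | ∃ h : (Ioo a b).Nonempty, z = h.some}) ∪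
    ⋃ a ∈ Sigma.mk i ⁻¹' A, ⋃ U ∈ B ∩ boxSupersets A, intervalEnds (Function.eval i '' U) a)

theorem closureStep_countable [Countable ι] {B : Set (Set (∀ i, X i))}
    (hB : ∀ W : Set (∀ i, X i), IsOpen W → W.Nonempty → {U ∈ B | W ⊆ U}.Countable)
    {A : Set (Σ i, X i)} (hA : A.Countable) : (closureStep B A).Countable := by
  have hAi (i : ι) : (Sigma.mk i ⁻¹' A).Countable := hA.preimage sigma_mk_injective
  refine hA.union (countable_iUnion fun i => Countable.image (.union (.union (.union ?_ ?_) ?_) ?_) _)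
  · exact subsingleton_isBot _ |>.countable
  · exact subsingleton_isTop _ |>.countable
  · refine (hAi i).biUnion fun a _ => (hAi i).biUnion fun b _ => Set.Subsingleton.countable ?_
    rintro _ ⟨h, rfl⟩ _ ⟨h', rfl⟩
    rfl
  · exact (hAi i).biUnion fun a _ => (inter_boxSupersets_countable hB hA).biUnion fun U _ =>
      intervalEnds_countable _ _

theorem exists_countable_closed [Countable ι] {B : Set (Set (∀ i, X i))}
    (hB : ∀ W : Set (∀ i, X i), IsOpen W → W.Nonempty → {U ∈ B | W ⊆ U}.Countable) :
    ∃ A : Set (Σ i, X i), A.Countable ∧ (∀ i, BetweenClosed (Sigma.mk i ⁻¹' A)) ∧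
      ∀ U ∈ B ∩ boxSupersets A, ∀ i, ∀ a ∈ Sigma.mk i ⁻¹' A,
        intervalEnds (Function.eval i '' U) a ⊆ Sigma.mk i ⁻¹' A := by
  let A : ℕ → Set (Σ i, X i) := fun n => (closureStep B)^[n] ∅
  have hsucc (n : ℕ) : A (n + 1) = closureStep B (A n) := Function.iterate_succ_apply' _ _ _
  have hmono : Monotone A := monotone_nat_of_le_succ fun n => by
    rw [hsucc]; exact subset_union_left
  have hcount (n : ℕ) : (A n).Countable := by
    induction n with
    | zero => exact countable_empty
    | succ n ih => rw [hsucc]; exact closureStep_countable hB ih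
  have hstep (n : ℕ) : closureStep B (A n) ⊆ ⋃ n, A n := hsucc n ▸ subset_iUnion A (n + 1)
  refine ⟨⋃ n, A n, countable_iUnion hcount, fun i => ⟨fun x hx => ?_, fun x hx => ?_, ?_⟩, ?_⟩
  · exact hstep 0 (Or.inr (mem_iUnion.2 ⟨i, x, Or.inl (Or.inl (Or.inl hx)), rfl⟩))
  · exact hstep 0 (Or.inr (mem_iUnion.2 ⟨i, x, Or.inl (Or.inl (Or.inr hx)), rfl⟩))
  · intro a ha b hb hab
    obtain ⟨n, ha⟩ := mem_iUnion.1 ha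
    obtain ⟨m, hb⟩ := mem_iUnion.1 hb
    refine ⟨hab.some, hab.some_mem, hstep (max n m) (Or.inr (mem_iUnion.2 ⟨i, _, Or.inl (Or.inr
      (mem_biUnion (x := a) ?_ (mem_biUnion (x := b) ?_ ⟨hab, rfl⟩))), rfl⟩))⟩
    · exact hmono (le_max_left _ _) ha
    · exact hmono (le_max_right _ _) hb
  · rintro U ⟨hUB, hU⟩ i a ha s hs
    obtain ⟨n, ha⟩ := mem_iUnion.1 ha
    obtain ⟨m, hU⟩ := mem_iUnion.1 (boxSupersets_iUnion hmono hU)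
    have hU' : U ∈ boxSupersets (A (max n m)) := by
      obtain ⟨C, hC, hCA, h⟩ := hU
      exact ⟨C, hC, hCA.trans (traceCylinders_mono (hmono (le_max_right _ _))), h⟩
    refine hstep (max n m) (Or.inr (mem_iUnion.2 ⟨i, s, Or.inr
      (mem_biUnion (x := a) ?_ (mem_biUnion (x := U) ⟨hUB, hU'⟩ hs)), rfl⟩))
    exact hmono (le_max_left _ _) ha

theorem countable_of_countable_supersets [Countable ι] [∀ i, OrderTopology (X i)]
    [∀ i, CompactSpace (X i)] {B : Set (Set (∀ i, X i))} (hbasis : IsTopologicalBasis B)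
    (hB : ∀ W : Set (∀ i, X i), IsOpen W → W.Nonempty → {U ∈ B | W ⊆ U}.Countable) :
    B.Countable := by
  classical
  rcases isEmpty_or_nonempty (∀ i, X i) with he | ⟨⟨x₀⟩⟩
  · exact B.to_countable
  obtain ⟨A, hAc, hA, hends⟩ := exists_countable_closed hB
  have hne (i : ι) : Nonempty (X i) := ⟨x₀ i⟩
  choose c hc using fun i => (hA i).exists_captured
  have hdense (i : ι) : Dense (Sigma.mk i ⁻¹' A) := by
    refine (hA i).dense fun p hp W hW => ?_
    let q := Function.update c i p
    have hqi : q i = p := Function.update_self ..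
    have hq (j : ι) : Captured (Sigma.mk j ⁻¹' A) (q j) := by
      rcases eq_or_ne j i with rfl | hj
      · rwa [hqi]
      · simpa [q, Function.update_of_ne hj] using hc j
    obtain ⟨U, hU, hqU, hUW⟩ := hbasis.mem_nhds_iff.1
      ((continuous_apply i).continuousAt.preimage_mem_nhds (x := q) (hqi.symm ▸ hW))
    have hUn := (hbasis.isOpen hU).mem_nhds hqU
    refine ⟨Function.eval i '' U, ?_, image_subset_iff.2 hUW,
      fun a ha _ => hends U ⟨hU, mem_boxSupersets hq hUn⟩ i a ha⟩
    have := (isOpenMap_eval i).image_mem_nhds hUn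
    rwa [Function.eval, hqi] at this
  refine ((inter_boxSupersets_countable hB hAc).union (countable_singleton ∅)).mono fun U hU => ?_
  rcases U.eq_empty_or_nonempty with rfl | ⟨x, hx⟩
  · exact Or.inr rfl
  · exact Or.inl ⟨hU, mem_boxSupersets (fun i => (hdense i).captured (x i))
      ((hbasis.isOpen hU).mem_nhds hx)⟩

end Pi

theorem HasOpLikeBase.mono {κ μ : Cardinal.{u}} (h : κ ≤ μ) {X : Type u} [TopologicalSpace X]
    (hX : HasOpLikeBase κ X) : HasOpLikeBase μ X :=
  let ⟨B, hB, hκ⟩ := hX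
  ⟨B, hB, fun a ha => hκ a (h.trans ha)⟩

theorem HasOpLikeBase.of_homeomorph {κ : Cardinal.{u}} {X Y : Type u} [TopologicalSpace X]
    [TopologicalSpace Y] (e : Y ≃ₜ X) (hX : HasOpLikeBase κ X) : HasOpLikeBase κ Y := by
  obtain ⟨B, hB, hκ⟩ := hX
  refine ⟨_, hB.isInducing e.isInducing, ?_⟩
  rintro ⟨_, V, hV, rfl⟩ h
  refine hκ ⟨V, hV⟩ (h.trans (Cardinal.mk_le_of_surjective
    (f := fun U : {U : B // ⟨V, hV⟩ ≤ U} => ⟨⟨e ⁻¹' U.1.1, U.1.1, U.1.2, rfl⟩,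
      preimage_mono (f := e) (show V ⊆ U.1.1 from U.2)⟩) ?_))
  rintro ⟨⟨_, U, hU, rfl⟩, hVU⟩
  exact ⟨⟨⟨U, hU⟩, (preimage_subset_preimage_iff (by simp [e.surjective.range_eq])).1 hVU⟩, rfl⟩

theorem IsOpLike.countable_supersets {X : Type u} [TopologicalSpace X] {B : Set (Set X)}
    (hbasis : IsTopologicalBasis B) (hB : IsOpLike ℵ₁ B) {W : Set X} (hW : IsOpen W)
    (hne : W.Nonempty) : {U ∈ B | W ⊆ U}.Countable := by
  obtain ⟨x, hx⟩ := hne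
  obtain ⟨V, hV, -, hVW⟩ := hbasis.exists_subset_of_mem_open hx hW
  have h := hB ⟨V, hV⟩
  rw [not_le, Cardinal.lt_aleph_one_iff, Cardinal.mk_le_aleph0_iff] at h
  refine (countable_range fun b : {b : B // (⟨V, hV⟩ : B) ≤ b} => b.1.1).mono ?_
  rintro U ⟨hU, hWU⟩
  exact ⟨⟨⟨U, hU⟩, hVW.trans hWU⟩, rfl⟩

theorem metrizableSpace_pi_of_hasOpLikeBase {ι : Type*} [Countable ι] {X : ι → Type*}
    [∀ i, LinearOrder (X i)] [∀ i, TopologicalSpace (X i)] [∀ i, OrderTopology (X i)]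
    [∀ i, CompactSpace (X i)] (h : HasOpLikeBase ℵ₁ (∀ i, X i)) : MetrizableSpace (∀ i, X i) := by
  obtain ⟨B, hbasis, hB⟩ := h
  have := hbasis.secondCountableTopology
    (countable_of_countable_supersets hbasis fun _ => hB.countable_supersets hbasis)
  exact metrizableSpace_of_t3_secondCountable _

theorem hasOpLikeBase_aleph0_of_metrizableSpace (X : Type u) [TopologicalSpace X] [CompactSpace X]
    [MetrizableSpace X] : HasOpLikeBase ℵ₀ X := by
  let _ := metrizableSpaceMetric X
  have hr (n : ℕ) : (0 : ℝ) < 1 / ((n : ℝ) + 1) := Nat.one_div_pos_of_nat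
  choose F hFu hF hcover using fun n : ℕ =>
    finite_cover_balls_of_compact (isCompact_univ (X := X)) (hr n)
  let 𝓑 (n : ℕ) : Set (Set X) := (fun x => Metric.ball x (1 / ((n : ℝ) + 1))) '' F n
  have hfin (N : ℕ) : (⋃ n ∈ Iio N, 𝓑 n).Finite := (finite_Iio N).biUnion fun n _ => (hF n).image _
  refine ⟨⋃ n, 𝓑 n, isTopologicalBasis_of_isOpen_of_nhds ?_ ?_, ?_⟩
  · intro U hU
    obtain ⟨n, x, -, rfl⟩ := mem_iUnion.1 hU
    exact Metric.isOpen_ball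
  · intro x U hx hU
    obtain ⟨ε, hε, hεU⟩ := Metric.isOpen_iff.1 hU x hx
    obtain ⟨n, hn⟩ := exists_nat_one_div_lt (half_pos hε)
    obtain ⟨y, hy, hxy⟩ := mem_iUnion₂.1 (hcover n (mem_univ x))
    refine ⟨_, mem_iUnion.2 ⟨n, y, hy, rfl⟩, hxy, fun z hz => hεU ?_⟩
    have h1 := dist_triangle_right z x y
    rw [Metric.mem_ball] at *
    linarith
  · rintro ⟨V, hV⟩ h
    refine h.not_gt (Cardinal.lt_aleph0_iff_finite.2 ?_)
    suffices hs : {U ∈ ⋃ n, 𝓑 n | V ⊆ U}.Finite from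
      have := hs.to_subtype
      Finite.of_injective (fun b => (⟨b.1.1, b.1.2, b.2⟩ : {U ∈ ⋃ n, 𝓑 n | V ⊆ U}))
        fun b b' hbb => Subtype.ext (Subtype.ext (congrArg (fun c => c.1) hbb))
    obtain ⟨m, x, -, rfl⟩ := mem_iUnion.1 hV
    set V := Metric.ball x (1 / ((m : ℝ) + 1)) with hVdef
    have hxV : x ∈ V := Metric.mem_ball_self (hr m)
    by_cases hex : ∃ y ∈ V, y ≠ x
    · obtain ⟨y, hyV, hyx⟩ := hex
      obtain ⟨N, hN⟩ := exists_nat_one_div_lt (half_pos (dist_pos.2 hyx))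
      refine (hfin N).subset ?_
      rintro U ⟨hU, hVU⟩
      obtain ⟨n, z, hz, rfl⟩ := mem_iUnion.1 hU
      refine mem_biUnion (x := n) ?_ ⟨z, hz, rfl⟩
      by_contra hn
      have h1 := Nat.one_div_le_one_div (α := ℝ) (not_lt.1 hn)
      have h2 := hVU hyV
      have h3 := hVU hxV
      have h4 := dist_triangle_right y x z
      rw [Metric.mem_ball] at h2 h3
      linarith
    · push Not at hex
      refine ((hfin (m + 1)).union (finite_singleton V)).subset ?_
      rintro U ⟨hU, hVU⟩
      obtain ⟨n, z, hz, rfl⟩ := mem_iUnion.1 hU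
      by_cases hn : n < m + 1
      · exact Or.inl (mem_biUnion (x := n) hn ⟨z, hz, rfl⟩)
      right
      have h1 := Nat.one_div_le_one_div (α := ℝ) (show m ≤ n by omega)
      have h3 := hVU hxV
      rw [Metric.mem_ball] at h3
      have hzx : z = x := hex z (by rw [hVdef, Metric.mem_ball, dist_comm]; linarith)
      subst hzx
      exact Subset.antisymm (Metric.ball_subset_ball h1) hVU

theorem mainTheorem3 :
    (∀ (ι : Type*) [Countable ι] (X : ι → Type*)
        [∀ i, LinearOrder (X i)] [∀ i, TopologicalSpace (X i)]
        [∀ i, OrderTopology (X i)] [∀ i, CompactSpace (X i)],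
      List.TFAE [
        TopologicalSpace.MetrizableSpace (∀ i, X i),
        HasOpLikeBase ℵ₀ (∀ i, X i),
        HasOpLikeBase ℵ₁ (∀ i, X i),
        TopologicalSpace.SeparableSpace (∀ i, X i) ∧ HasOpLikeBase ℵ₁ (∀ i, X i)]) ∧
    (∀ (Y : Type*) [LinearOrder Y] [TopologicalSpace Y] [OrderTopology Y] [CompactSpace Y],
      noetherianType Y ≠ ℵ₁) := by
  refine ⟨?_, ?_⟩
  · intro ι _ X _ _ _ _
    tfae_have 1 → 2 := fun _ => hasOpLikeBase_aleph0_of_metrizableSpace _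
    tfae_have 2 → 3 := HasOpLikeBase.mono (Cardinal.aleph0_le_aleph 1)
    tfae_have 3 → 1 := metrizableSpace_pi_of_hasOpLikeBase
    tfae_have 4 → 3 := And.right
    tfae_have 3 → 4 := fun h => by
      have := metrizableSpace_pi_of_hasOpLikeBase h
      let _ := metrizableSpaceMetric (∀ i, X i)
      exact ⟨inferInstance, h⟩
    tfae_finish
  · intro Y _ _ _ _ hY
    have h := (noetherianType_spec Y).2
    rw [hY] at h
    let e : (Unit → Y) ≃ₜ Y := Homeomorph.funUnique Unit Y
    have := metrizableSpace_pi_of_hasOpLikeBase (h.of_homeomorph e)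
    have := e.symm.isEmbedding.metrizableSpace
    have hle : noetherianType Y ≤ ℵ₀ :=
      csInf_le' ⟨le_rfl, hasOpLikeBase_aleph0_of_metrizableSpace Y⟩
    exact (hY ▸ hle).not_gt Cardinal.aleph0_lt_aleph_one
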